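/- Let $M\ge 0$ and $k\ge 1$ be integers, let $V^{k},V^{k+1},\dots,V^{k+M}$ be finite-dimensional complex vector spaces, and let $\mathbb P=\mathbb P\big(\bigoplus_{i=0}^M (V^{k+i})^*\big)$ be the weighted projective space $\big(\bigoplus_i (V^{k+i})^*\setminus\{0\}\big)/\mathbb C^*$, where $\mathbb C^*$ acts on $(V^{k+i})^*$ with weight $k+i$. It has the orbifold charts $\{v : v(w)=1\}\to\mathbb P$ for $w\in V^{k+i}$, with group the $(k+i)$-th roots of unity, and carries the tautological orbifold line bundle $\mathcal O_{\mathbb P}(-1)$, whose fibre over $[v]$ is the orbit of $v$ together with $0$, and its dual $\mathcal O_{\mathbb P}(1)$. Let $X_1,X_2\subset\mathbb P$ be compact embedded orbifolds: closed subsets whose preimages in the orbifold charts are complex submanifolds, on which the groups of the charts act effectively near every point; they carry the orbifold structure pulled back from $\mathbb P$ and the polarisation $\mathcal O_{X_j}(1)=\mathcal O_{\mathbb P}(1)|_{X_j}$. Suppose that both are normally embedded, i.e. for every $i=0,\dots,M$ restriction to $X_j$ of the coordinates of weight $k+i$ is an isomorphism $$V^{k+i}\ \xrightarrow{\ \sim\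 }\ H^0(X_j,\mathcal O_{X_j}(k+i)).$$ (If $k>M$, then $V^{k+i}=H^0(\mathbb P,\mathcal O_{\mathbb P}(k+i))$, and the condition is that the restriction maps $H^0(\mathbb P,\mathcal O_{\mathbb P}(k+i))\to H^0(X_j,\mathcal O_{X_j}(k+i))$ are isomorphisms.) Then $(X_1,\mathcal O_{X_1}(1))$ and $(X_2,\mathcal O_{X_2}(1))$ are isomorphic as polarised orbifolds (there is an isomorphism of orbifolds $f\colon X_1\to X_2$ with $f^*\mathcal O_{X_2}(1)\cong\mathcal O_{X_1}(1)$ as orbifold line bundles) if and only if there is $g\in\prod_i GL(V^{k+i})$ with $g\cdot X_1=X_2$. -/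

import Mathlib

open Set Topology

noncomputable section

namespace WeightedEmbedding

/-! ### Holomorphic maps and complex submanifolds -/

section Analysis

variable {E F : Type*} [NormedAddCommGroup E] [NormedSpace ℂ E]
  [NormedAddCommGroup F] [NormedSpace ℂ F]

/-- A map defined on a subset `S` of a complex normed space is holomorphic if near every point of
`S` it is the restriction of a holomorphic map defined on an open subset of the ambient space.
(On a complex submanifold this is holomorphy in the usual sense.) -/
def IsHolomorphic {S : Set E} (φ : S → F) : Prop :=
  ∀ p : S, ∃ O : Set E, IsOpen O ∧ (p : E) ∈ O ∧
    ∃ Φ : E → F, DifferentiableOn ℂ Φ O ∧ ∀ y : S, (y : E) ∈ O → Φ y = φ y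

/-- `S` is an (embedded) complex submanifold of dimension `n`: near each of its points a
biholomorphic change of coordinates `Φ` takes `S` to an `n`-dimensional linear subspace. -/
def IsComplexSubmanifold (n : ℕ) (S : Set E) : Prop :=
  ∀ p ∈ S, ∃ (Φ : OpenPartialHomeomorph E E) (K : Submodule ℂ E),
    p ∈ Φ.source ∧ DifferentiableOn ℂ Φ Φ.source ∧ DifferentiableOn ℂ Φ.symm Φ.target ∧
    Module.finrank ℂ K = n ∧ Φ '' (S ∩ Φ.source) = (K : Set E) ∩ Φ.target

theorem IsHolomorphic.add {S : Set E} {φ ψ : S → F} (h : IsHolomorphic φ)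
    (h' : IsHolomorphic ψ) : IsHolomorphic (fun y => φ y + ψ y) := by
  intro p
  obtain ⟨O, hO, hp, Φ, hΦ, e⟩ := h p
  obtain ⟨O', hO', hp', Φ', hΦ', e'⟩ := h' p
  refine ⟨O ∩ O', hO.inter hO', ⟨hp, hp'⟩, fun y => Φ y + Φ' y,
    (hΦ.mono inter_subset_left).add (hΦ'.mono inter_subset_right), fun y hy => ?_⟩
  simp only [e y hy.1, e' y hy.2]

theorem IsHolomorphic.const_smul {S : Set E} {φ : S → F} (h : IsHolomorphic φ) (a : ℂ) :
    IsHolomorphic (fun y => a • φ y) := by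
  intro p
  obtain ⟨O, hO, hp, Φ, hΦ, e⟩ := h p
  exact ⟨O, hO, hp, fun y => a • Φ y, hΦ.const_smul a, fun y hy => by simp only [e y hy]⟩

theorem IsHolomorphic.of_differentiable (S : Set E) {Φ : E → F} (h : Differentiable ℂ Φ) :
    IsHolomorphic (fun y : S => Φ y) := fun _ =>
  ⟨univ, isOpen_univ, mem_univ _, Φ, h.differentiableOn, fun _ _ => rfl⟩

theorem IsHolomorphic.restrict {S T : Set E} (hST : S ⊆ T) {φ : T → F} (h : IsHolomorphic φ) :
    IsHolomorphic (fun y : S => φ ⟨y, hST y.2⟩) := fun p => by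
  obtain ⟨O, hO, hp, Φ, hΦ, e⟩ := h ⟨p, hST p.2⟩
  exact ⟨O, hO, hp, Φ, hΦ, fun y hy => e ⟨y, hST y.2⟩ hy⟩

end Analysis

variable {M : ℕ} (k : ℕ) (W : Fin (M + 1) → Type*)
  [∀ i, NormedAddCommGroup (W i)] [∀ i, NormedSpace ℂ (W i)]

/-! ### The weighted projective space `ℙ(⨁ᵢ (W i)^*)`

The space `W i` (for `i = 0, …, M`) is the fixed vector space written `V^{k+i}` on paper.
The norms only serve to speak of holomorphic maps; the spaces are finite dimensional. -/

/-- The graded vector space `⨁ᵢ (W i)^*`. -/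
abbrev DualSum : Type _ := ∀ i, W i →L[ℂ] ℂ

variable {W}

/-- The weighted action of scalars on `⨁ᵢ (W i)^*`: the `i`-th summand has weight `k + i`. -/
def wsmul (t : ℂ) (v : DualSum W) : DualSum W := fun i => t ^ (k + (i : ℕ)) • v i

theorem wsmul_mul (s t : ℂ) (v : DualSum W) : wsmul k (s * t) v = wsmul k s (wsmul k t v) := by
  funext i; simp only [wsmul, mul_pow, smul_smul]

theorem wsmul_one (v : DualSum W) : wsmul k 1 v = v := by
  funext i; simp [wsmul]

theorem wsmul_inv (t : ℂˣ) (v : DualSum W) : wsmul k (t⁻¹ : ℂˣ) (wsmul k t v) = v := by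
  rw [← wsmul_mul, Units.inv_mul, wsmul_one]

variable (W)

/-- Two nonzero vectors are equivalent if they lie in the same `ℂ^*`-orbit. -/
def orbitSetoid : Setoid {v : DualSum W // v ≠ 0} where
  r v v' := ∃ t : ℂˣ, (v' : DualSum W) = wsmul k t v
  iseqv :=
    { refl := fun v => ⟨1, by simp [wsmul_one]⟩
      symm := by
        rintro v v' ⟨t, h⟩
        exact ⟨t⁻¹, by rw [h, wsmul_inv]⟩
      trans := by
        rintro v v' v'' ⟨t, h⟩ ⟨t', h'⟩
        exact ⟨t' * t, by rw [h', h, Units.val_mul, wsmul_mul]⟩ }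

/-- Weighted projective space `ℙ(⨁ᵢ (W i)^*)`, the quotient of the nonzero vectors by `ℂ^*`. -/
def WProj : Type _ := Quotient (orbitSetoid k W)

instance : TopologicalSpace (WProj k W) :=
  inferInstanceAs (TopologicalSpace (Quotient (orbitSetoid k W)))

variable {k W}

/-- The point `[v]` of weighted projective space. -/
def WProj.mk (v : DualSum W) (hv : v ≠ 0) : WProj k W :=
  Quotient.mk (orbitSetoid k W) ⟨v, hv⟩

/-- `v` is a nonzero vector with `[v] = x`, i.e. `v` lies on the `ℂ^*`-orbit `x`. -/
def IsLift (v : DualSum W) (x : WProj k W) : Prop := ∃ hv : v ≠ 0, WProj.mk v hv = x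

/-- The union of the `ℂ^*`-orbits belonging to `X ⊆ ℙ`. -/
def cone (X : Set (WProj k W)) : Set (DualSum W) := {v | ∃ x ∈ X, IsLift v x}

/-- The index of an orbifold chart of `ℙ`: a linear coordinate `w ∈ W i` of some weight `k + i`. -/
abbrev ChartIndex (W : Fin (M + 1) → Type*) : Type _ := Σ i, W i

/-- The part over `X` of the orbifold chart of `ℙ` belonging to the coordinate `c = w ∈ W i`.
The chart of `ℙ` is the affine slice `{v | v(w) = 1}`, with the `(k+i)`-th roots of unity acting
through the weighted action, and with the chart map `v ↦ [v]`. -/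
def chart (X : Set (WProj k W)) (c : ChartIndex W) : Set (DualSum W) :=
  {v | v ∈ cone X ∧ v c.1 c.2 = 1}

/-- `X ⊆ ℙ` is a compact orbifold embedded in `ℙ`, with the orbifold structure pulled back from
`ℙ`: `X` is closed, its preimage in every orbifold chart of `ℙ` is a complex submanifold, and the
group of the chart (roots of unity of order the weight) acts effectively on it, near every point. -/
def IsEmbeddedOrbifold (X : Set (WProj k W)) : Prop :=
  IsClosed X ∧ ∃ n : ℕ, ∀ c : ChartIndex W,
    IsComplexSubmanifold n (chart X c) ∧
    ∀ z ∈ chart X c, ∀ t : ℂ, t ^ (k + (c.1 : ℕ)) = 1 →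
      (∀ᶠ y in 𝓝[chart X c] z, wsmul k t y = y) → t = 1

/-! ### Sections of `𝒪_X(d)` and normal embeddings -/

/-- The space `H⁰(X, 𝒪_X(d))`. The fibre of `𝒪(-1)` over `[v]` is the orbit of `v` together
with `0`, so a section of `𝒪(d)` is a function on the nonzero vectors of `𝒪_X(-1)` that is
homogeneous of degree `d` along the orbits; it has to be holomorphic in every orbifold chart
(where the slice trivialises `𝒪(-1)`; invariance under the group of the chart is part of the
homogeneity). -/
def sections (X : Set (WProj k W)) (d : ℕ) : Submodule ℂ (cone X → ℂ) where
  carrier := {s | (∀ (t : ℂˣ) (v v' : cone X), (v' : DualSum W) = wsmul k t v →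
      s v' = (t : ℂ) ^ d * s v) ∧
    ∀ c : ChartIndex W, IsHolomorphic (fun y : chart X c => s ⟨y, y.2.1⟩)}
  add_mem' := by
    rintro s s' ⟨h, hc⟩ ⟨h', hc'⟩
    refine ⟨fun t v v' e => ?_, fun c => (hc c).add (hc' c)⟩
    simp only [Pi.add_apply, h t v v' e, h' t v v' e, mul_add]
  zero_mem' := ⟨fun t v v' e => by simp, fun c =>
    IsHolomorphic.of_differentiable _ (Φ := fun _ => (0 : ℂ)) (differentiable_const _)⟩
  smul_mem' := by
    rintro a s ⟨h, hc⟩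
    refine ⟨fun t v v' e => ?_, fun c => (hc c).const_smul a⟩
    simp only [Pi.smul_apply, h t v v' e, smul_eq_mul]
    ring

theorem cone_subset_univ (X : Set (WProj k W)) : cone X ⊆ cone (univ : Set (WProj k W)) :=
  fun _ ⟨x, _, h⟩ => ⟨x, mem_univ x, h⟩

theorem chart_subset_univ (X : Set (WProj k W)) (c : ChartIndex W) :
    chart X c ⊆ chart (univ : Set (WProj k W)) c :=
  fun _ h => ⟨cone_subset_univ X h.1, h.2⟩

/-- The restriction map `H⁰(ℙ, 𝒪_ℙ(d)) → H⁰(X, 𝒪_X(d))`. -/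
def restrictSections (X : Set (WProj k W)) (d : ℕ) :
    sections (univ : Set (WProj k W)) d →ₗ[ℂ] sections X d where
  toFun s := ⟨fun v => s.1 ⟨v, cone_subset_univ X v.2⟩,
    fun t v v' e => s.2.1 t ⟨v, cone_subset_univ X v.2⟩ ⟨v', cone_subset_univ X v'.2⟩ e,
    fun c => (s.2.2 c).restrict (chart_subset_univ X c)⟩
  map_add' _ _ := rfl
  map_smul' _ _ := rfl

/-- A vector `w ∈ W i` is a linear coordinate of weight `k + i` on `⨁ᵢ (W i)^*`, hence a section
of `𝒪_ℙ(k + i)`. -/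
def coordSection (k : ℕ) (i : Fin (M + 1)) :
    W i →ₗ[ℂ] sections (univ : Set (WProj k W)) (k + (i : ℕ)) where
  toFun w := ⟨fun v => (v : DualSum W) i w,
    fun t v v' e => by simp [e, wsmul],
    fun c => IsHolomorphic.of_differentiable _ (Φ := fun v : DualSum W => v i w) (by fun_prop)⟩
  map_add' _ _ := by ext; simp
  map_smul' _ _ := by ext; simp

/-- `X ⊆ ℙ` is normally embedded: for every `i` the restriction of the coordinates of weight
`k + i` is an isomorphism `W i ≅ H⁰(X, 𝒪_X(k + i))`. When `k > M` there are no products of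
coordinates of weight at most `k + M`, so that `W i` is all of `H⁰(ℙ, 𝒪_ℙ(k + i))`, and this
says that the restriction maps `H⁰(ℙ, 𝒪_ℙ(k + i)) → H⁰(X, 𝒪_X(k + i))` are isomorphisms. -/
def IsNormallyEmbedded (X : Set (WProj k W)) : Prop :=
  ∀ i : Fin (M + 1), Function.Bijective
    ((restrictSections X (k + (i : ℕ))) ∘ₗ (coordSection (W := W) k i))

/-! ### Isomorphisms of polarised orbifolds -/

/-- The stabiliser in `ℂ^*` of a vector under the weighted action. For a vector on the slice of a
coordinate of weight `k + i` it consists of `(k+i)`-th roots of unity, and is the stabiliser in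
the group of the chart. -/
def stab (k : ℕ) (v : DualSum W) : Subgroup ℂˣ where
  carrier := {t | wsmul k t v = v}
  mul_mem' := by
    intro s t hs ht
    simp only [mem_ofPred_eq] at hs ht ⊢
    rw [Units.val_mul, wsmul_mul, ht, hs]
  one_mem' := by simp [wsmul_one]
  inv_mem' := by
    intro t ht
    simp only [mem_ofPred_eq] at ht ⊢
    nth_rewrite 1 [← ht]
    exact wsmul_inv k t v

/-- A lift to orbifold charts around `x` of a homeomorphism `f` of underlying spaces: a
biholomorphic map `φ` from a neighbourhood of a point `z` over `x` in an orbifold chart of `X` to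
a neighbourhood of a point over `f x` in an orbifold chart of `Y`, which covers `f` and is
equivariant for an isomorphism `θ` of the stabiliser groups of these points. -/
structure ChartLift {X Y : Set (WProj k W)} (f : X ≃ₜ Y) (x : X) where
  /-- the chart of `X` -/
  a : ChartIndex W
  /-- the chart of `Y` -/
  b : ChartIndex W
  O : Set (DualSum W)
  O' : Set (DualSum W)
  isOpen_O : IsOpen O
  isOpen_O' : IsOpen O'
  /-- the biholomorphic map -/
  φ : (chart X a ∩ O : Set (DualSum W)) ≃ (chart Y b ∩ O' : Set (DualSum W))
  holomorphic : IsHolomorphic (fun y => (φ y : DualSum W))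
  holomorphic_symm : IsHolomorphic (fun y => (φ.symm y : DualSum W))
  /-- the point over `x` -/
  z : (chart X a ∩ O : Set (DualSum W))
  isLift_z : IsLift (z : DualSum W) (x : WProj k W)
  covers : ∀ (y : (chart X a ∩ O : Set (DualSum W))) (x' : X),
    IsLift (y : DualSum W) (x' : WProj k W) → IsLift (φ y : DualSum W) (f x' : WProj k W)
  θ : stab k (z : DualSum W) ≃* stab k (φ z : DualSum W)
  stable : ∀ (t : stab k (z : DualSum W)) (y : (chart X a ∩ O : Set (DualSum W))),
    wsmul k ((t : ℂˣ) : ℂ) y ∈ (chart X a ∩ O : Set (DualSum W))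
  equivariant : ∀ (t : stab k (z : DualSum W)) (y : (chart X a ∩ O : Set (DualSum W))),
    (φ ⟨wsmul k ((t : ℂˣ) : ℂ) y, stable t y⟩ : DualSum W) = wsmul k ((θ t : ℂˣ) : ℂ) (φ y)

/-- An isomorphism of embedded orbifolds: a homeomorphism of the underlying spaces that lifts, at
every point, to an equivariant biholomorphic map of orbifold charts. -/
def IsOrbifoldIso {X Y : Set (WProj k W)} (f : X ≃ₜ Y) : Prop :=
  ∀ x : X, Nonempty (ChartLift f x)

/-- The total space of the tautological orbifold line bundle `𝒪_X(-1)`: its fibre over `x ∈ X`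
is the `ℂ^*`-orbit `x` together with `0`. Over an orbifold chart it is trivialised by
`(y, s) ↦ ([y], s · y)`, where `s ∈ ℂ` acts by the weighted action. -/
def TautBundle (X : Set (WProj k W)) : Type _ :=
  {p : X × DualSum W // p.2 = 0 ∨ IsLift p.2 (p.1 : WProj k W)}

/-- `F` is an isomorphism of orbifold line bundles `𝒪_X(-1) → f^* 𝒪_Y(-1)` (equivalently, by
duality, it is an isomorphism `f^* 𝒪_Y(1) → 𝒪_X(1)`): over suitable orbifold charts around every
point it is given in the trivialisations by multiplication with a nowhere vanishing holomorphic
function `u` which is compatible with the actions of the stabiliser groups on the lines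
(the element `t` takes `(y, s)` to `(t · y, t⁻¹ s)`). -/
def IsTautIso {X Y : Set (WProj k W)} (f : X ≃ₜ Y) (F : TautBundle X ≃ TautBundle Y) : Prop :=
  ∀ x : X, ∃ (l : ChartLift f x) (u : (chart X l.a ∩ l.O : Set (DualSum W)) → ℂ),
    IsHolomorphic u ∧ (∀ y, u y ≠ 0) ∧
    (∀ (t : stab k (l.z : DualSum W)) (y : (chart X l.a ∩ l.O : Set (DualSum W))),
      ((t : ℂˣ) : ℂ)⁻¹ * u ⟨wsmul k ((t : ℂˣ) : ℂ) y, l.stable t y⟩ =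
        ((l.θ t : ℂˣ) : ℂ)⁻¹ * u y) ∧
    ∀ (y : (chart X l.a ∩ l.O : Set (DualSum W))) (s : ℂ) (p : TautBundle X),
      IsLift (y : DualSum W) (p.1.1 : WProj k W) → p.1.2 = wsmul k s y →
        (F p).1.1 = f p.1.1 ∧ (F p).1.2 = wsmul k (s * u y) (l.φ y)

/-- `(X, 𝒪_X(1))` and `(Y, 𝒪_Y(1))` are isomorphic as polarised orbifolds: there is an
isomorphism `f` of orbifolds together with an isomorphism of `𝒪_X(1)` with `f^* 𝒪_Y(1)`. -/
def PolarisedIsomorphic (X Y : Set (WProj k W)) : Prop :=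
  ∃ f : X ≃ₜ Y, IsOrbifoldIso f ∧ ∃ F : TautBundle X ≃ TautBundle Y, IsTautIso f F

/-! ### The action of `∏ᵢ GL(W i)` -/

variable [∀ i, FiniteDimensional ℂ (W i)]

/-- The (contragredient) action of `∏ᵢ GL(W i)` on `⨁ᵢ (W i)^*`. -/
def glAct (g : ∀ i, LinearMap.GeneralLinearGroup ℂ (W i)) (v : DualSum W) : DualSum W :=
  fun i => (v i).comp (LinearMap.toContinuousLinearMap ((g i)⁻¹).1)

theorem glAct_ne_zero (g : ∀ i, LinearMap.GeneralLinearGroup ℂ (W i)) {v : DualSum W}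
    (hv : v ≠ 0) : glAct g v ≠ 0 := by
  intro h
  apply hv
  funext i
  ext w
  have h1 := congrArg (fun φ : W i →L[ℂ] ℂ => φ ((g i : W i →ₗ[ℂ] W i) w)) (congrFun h i)
  have h2 : ((g i)⁻¹ : LinearMap.GeneralLinearGroup ℂ (W i)).1 ((g i).1 w) = w := by
    rw [← Module.End.mul_apply, Units.inv_mul, Module.End.one_apply]
  simpa [glAct, h2] using h1

theorem glAct_wsmul (g : ∀ i, LinearMap.GeneralLinearGroup ℂ (W i)) (t : ℂ) (v : DualSum W) :
    glAct g (wsmul k t v) = wsmul k t (glAct g v) := by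
  funext i
  ext w
  simp [glAct, wsmul]

/-- The action of `∏ᵢ GL(W i)` on weighted projective space. -/
def projAct (g : ∀ i, LinearMap.GeneralLinearGroup ℂ (W i)) : WProj k W → WProj k W :=
  Quotient.map (fun v => ⟨glAct g v.1, glAct_ne_zero g v.2⟩) (by
    rintro v v' ⟨t, h⟩
    exact ⟨t, by simp only [h, glAct_wsmul]⟩)

end WeightedEmbedding

end

/-! Sections of `𝒪(d)` are functions of degree `d` on the cone of nonzero vectors of `𝒪(-1)`, so an
isomorphism of polarised orbifolds is best seen as a `ℂ^*`-equivariant map `G : cone X → cone Y`,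
obtained from the bundle isomorphism by discarding zero vectors (`exists_isConeIso`). Pulling back
along `G` preserves degree and holomorphy (`IsConeIso.comp_mem_sections`).

Normality identifies both `H⁰(X, 𝒪(k+i))` and `H⁰(Y, 𝒪(k+i))` with `W i`, so pullback becomes an
endomorphism `A` of `W i`. It is injective because `G` is surjective, hence invertible by finite
dimension. The coordinates of `G v` are those of `v` composed with `A`
(`IsConeIso.exists_linearMap`), so `G` is the restriction of a graded linear automorphism, which
carries `X` onto `Y`.

Conversely, `g` acts linearly on the cones, commutes with `ℂ^*` and permutes the affine slices, so
it is its own lift to every chart, with trivialising function `u = 1`. -/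

namespace WeightedEmbedding

variable {M : ℕ} {k : ℕ} {W : Fin (M + 1) → Type*}
  [∀ i, NormedAddCommGroup (W i)] [∀ i, NormedSpace ℂ (W i)]

/-! ### Lifts of points of weighted projective space -/

theorem wsmul_zero_right (t : ℂ) : wsmul k t (0 : DualSum W) = 0 := by
  funext i
  ext w
  simp [wsmul]

/-- Positivity of `k` matters here: a summand of weight `0` would be fixed, since `0 ^ 0 = 1`. -/
theorem wsmul_zero_left (hk : 0 < k) (v : DualSum W) : wsmul k 0 v = 0 := by
  funext i
  ext w
  simp [wsmul, hk.ne']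

theorem wsmul_ne_zero {t : ℂ} (ht : t ≠ 0) {v : DualSum W} (hv : v ≠ 0) : wsmul k t v ≠ 0 := by
  intro h
  apply hv
  rw [← wsmul_inv k (Units.mk0 t ht) v, Units.val_mk0, h, wsmul_zero_right]

theorem exists_isLift (x : WProj k W) : ∃ v : DualSum W, IsLift v x := by
  induction x using Quotient.inductionOn with
  | h v => exact ⟨v.1, v.2, rfl⟩

theorem IsLift.unique {v : DualSum W} {x x' : WProj k W} (h : IsLift v x) (h' : IsLift v x') :
    x = x' := by
  obtain ⟨_, rfl⟩ := h
  obtain ⟨_, rfl⟩ := h'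
  rfl

theorem IsLift.exists_eq_wsmul {v v' : DualSum W} {x : WProj k W} (h : IsLift v x)
    (h' : IsLift v' x) : ∃ t : ℂˣ, v' = wsmul k t v := by
  obtain ⟨hv, rfl⟩ := h
  obtain ⟨hv', e⟩ := h'
  exact Quotient.exact (s := orbitSetoid k W) e.symm

theorem IsLift.wsmul {v : DualSum W} {x : WProj k W} (h : IsLift v x) {t : ℂ} (ht : t ≠ 0) :
    IsLift (wsmul k t v) x := by
  obtain ⟨hv, rfl⟩ := h
  refine ⟨wsmul_ne_zero ht hv, Quotient.sound (s := orbitSetoid k W) ⟨(Units.mk0 t ht)⁻¹, ?_⟩⟩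
  exact (wsmul_inv k (Units.mk0 t ht) v).symm

theorem wsmul_mem_cone {X : Set (WProj k W)} {v : DualSum W} (hv : v ∈ cone X) {t : ℂ}
    (ht : t ≠ 0) : wsmul k t v ∈ cone X := by
  obtain ⟨x, hx, h⟩ := hv
  exact ⟨x, hx, h.wsmul ht⟩

/-! ### Slices of coordinates and scaling into them -/

theorem pow_eq_one_of_mem_stab {c : ChartIndex W} {v : DualSum W} (hv : v c.1 c.2 = 1) {t : ℂˣ}
    (ht : t ∈ stab k v) : (t : ℂ) ^ (k + (c.1 : ℕ)) = 1 := by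
  have h : wsmul k t v = v := ht
  have h' := congrArg (fun y : DualSum W => y c.1 c.2) h
  simpa [wsmul, hv] using h'

theorem wsmul_mem_chart {X : Set (WProj k W)} {c : ChartIndex W} {v : DualSum W} (hv : v ∈ chart X c) {t : ℂˣ}
    (ht : (t : ℂ) ^ (k + (c.1 : ℕ)) = 1) : wsmul k t v ∈ chart X c :=
  ⟨wsmul_mem_cone hv.1 t.ne_zero, by simp [wsmul, ht, hv.2]⟩

theorem exists_coord_eq_one {v : DualSum W} (hv : v ≠ 0) :
    ∃ c : ChartIndex W, v c.1 c.2 = 1 := by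
  obtain ⟨i, hi⟩ := Function.ne_iff.1 hv
  obtain ⟨w, hw⟩ := DFunLike.ne_iff.1 hi
  exact ⟨⟨i, (v i w)⁻¹ • w⟩, by simpa using inv_mul_cancel₀ hw⟩

theorem differentiableOn_wsmul {O : Set (DualSum W)} {τ : DualSum W → ℂ}
    (hτ : DifferentiableOn ℂ τ O) : DifferentiableOn ℂ (fun y => wsmul k (τ y) y) O := by
  rw [differentiableOn_pi]
  intro i
  exact (hτ.pow _).smul (by fun_prop)

/-- Near a point of its domain, an orbit map into the slice of a coordinate `a` is given by a
holomorphic function. -/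
theorem exists_scaling_to_slice (hk : 0 < k) (a : ChartIndex W) (p : DualSum W) {t : ℂ}
    (h : wsmul k t p a.1 a.2 = 1) :
    ∃ (O : Set (DualSum W)) (τ : DualSum W → ℂ), IsOpen O ∧ p ∈ O ∧ DifferentiableOn ℂ τ O ∧
      τ p = t ∧ ∀ y ∈ O, τ y ≠ 0 ∧ wsmul k (τ y) y a.1 a.2 = 1 := by
  have hm : k + (a.1 : ℕ) ≠ 0 := by omega
  have ht : t ≠ 0 := by
    rintro rfl
    simp [wsmul_zero_left hk] at h
  -- Scaling by the constant `t` makes the coordinate equal to `1` at `p` only. Dividing `t` by the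
  -- principal `(k+i)`-th root of the value `η y` corrects this nearby; the root is holomorphic off
  -- the branch cut and equals `1` at `p`.
  set η : DualSum W → ℂ := fun y => wsmul k t y a.1 a.2 with hη
  have hηd : Differentiable ℂ η := by
    simp only [hη, WeightedEmbedding.wsmul, smul_apply, smul_eq_mul]
    fun_prop
  have hroot : DifferentiableOn ℂ (fun y => η y ^ (((k + (a.1 : ℕ) : ℕ) : ℂ)⁻¹))
      (η ⁻¹' Complex.slitPlane) :=
    hηd.differentiableOn.cpow (differentiableOn_const _) fun y hy => hy
  have hne : ∀ y ∈ η ⁻¹' Complex.slitPlane, η y ^ (((k + (a.1 : ℕ) : ℕ) : ℂ)⁻¹) ≠ 0 := by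
    intro y hy h0
    exact Complex.slitPlane_ne_zero hy ((Complex.cpow_eq_zero_iff _ _).1 h0).1
  refine ⟨η ⁻¹' Complex.slitPlane, fun y => t / η y ^ (((k + (a.1 : ℕ) : ℕ) : ℂ)⁻¹),
    Complex.isOpen_slitPlane.preimage hηd.continuous, ?_, ?_, ?_, fun y hy => ⟨?_, ?_⟩⟩
  · simp [hη, h]
  · simp only [div_eq_mul_inv]
    exact (hroot.inv hne).const_mul t
  · simp [hη, h]
  · exact div_ne_zero ht (hne y hy)
  · have h1 : t ^ (k + (a.1 : ℕ)) * y a.1 a.2 = η y := by simp [hη, WeightedEmbedding.wsmul]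
    have h2 := Complex.slitPlane_ne_zero hy
    simp only [WeightedEmbedding.wsmul, smul_apply, smul_eq_mul, div_pow,
      Complex.cpow_nat_inv_pow _ hm]
    rw [div_mul_eq_mul_div, h1, div_self h2]

/-! ### Isomorphisms of polarised orbifolds as equivariant maps of cones -/

/-- A map of cones which commutes with the action of `ℂ^*` and is given near each point by a lift
to orbifold charts and a nowhere vanishing holomorphic function. -/
structure IsConeIso {X Y : Set (WProj k W)} (f : X ≃ₜ Y) (G : cone X → cone Y) : Prop where
  surjective : Function.Surjective G
  isLift : ∀ (v : cone X) (x : X), IsLift (v : DualSum W) (x : WProj k W) →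
    IsLift (G v : DualSum W) (f x : WProj k W)
  map_wsmul : ∀ (t : ℂˣ) (v v' : cone X), (v' : DualSum W) = wsmul k t v →
    (G v' : DualSum W) = wsmul k t (G v)
  exists_local : ∀ x : X, ∃ (l : ChartLift f x)
    (u : (chart X l.a ∩ l.O : Set (DualSum W)) → ℂ), IsHolomorphic u ∧ (∀ y, u y ≠ 0) ∧
      ∀ y : (chart X l.a ∩ l.O : Set (DualSum W)), (G ⟨y, y.2.1.1⟩ : DualSum W) = wsmul k (u y) (l.φ y)

/-- The local formula multiplies the scalar `s` by `u y`, so it gives equivariance along an orbit,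
and it sends zero vectors to zero vectors. Hence the preimage of a nonzero vector under the
bijection `F` is nonzero, which gives surjectivity. -/
theorem exists_isConeIso (hk : 0 < k) {X Y : Set (WProj k W)} {f : X ≃ₜ Y}
    {F : TautBundle X ≃ TautBundle Y} (hF : IsTautIso f F) :
    ∃ G : cone X → cone Y, IsConeIso f G := by
  have hfst : ∀ p, (F p).1.1 = f p.1.1 := by
    intro p
    obtain ⟨l, u, -, -, -, h⟩ := hF p.1.1
    rcases p.2 with h0 | h0
    · exact (h l.z 0 p l.isLift_z (by rw [h0, wsmul_zero_left hk])).1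
    · obtain ⟨s, hs⟩ := l.isLift_z.exists_eq_wsmul h0
      exact (h l.z s p l.isLift_z hs).1
  have hzero : ∀ p, p.1.2 = 0 → (F p).1.2 = 0 := by
    intro p h0
    obtain ⟨l, u, -, -, -, h⟩ := hF p.1.1
    rw [(h l.z 0 p l.isLift_z (by rw [h0, wsmul_zero_left hk])).2, zero_mul, wsmul_zero_left hk]
  have hlift : ∀ p, IsLift p.1.2 (p.1.1 : WProj k W) →
      IsLift (F p).1.2 (f p.1.1 : WProj k W) := by
    intro p h0
    obtain ⟨l, u, -, hu, -, h⟩ := hF p.1.1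
    obtain ⟨s, hs⟩ := l.isLift_z.exists_eq_wsmul h0
    rw [(h l.z s p l.isLift_z hs).2]
    exact (l.covers l.z p.1.1 l.isLift_z).wsmul (mul_ne_zero s.ne_zero (hu _))
  choose π hπ hπlift using fun v : cone X => v.2
  let P : cone X → TautBundle X := fun v => ⟨(⟨π v, hπ v⟩, v), Or.inr (hπlift v)⟩
  have hP : ∀ (v : cone X) (x : X), IsLift (v : DualSum W) (x : WProj k W) → (P v).1.1 = x :=
    fun v x h => Subtype.ext ((hπlift v).unique h)
  refine ⟨fun v => ⟨(F (P v)).1.2, f (P v).1.1, (f (P v).1.1).2, hlift _ (hπlift v)⟩,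
    ?_, ?_, ?_, ?_⟩
  · rintro ⟨v', y, hy, hv'⟩
    let q : TautBundle Y := ⟨(⟨y, hy⟩, v'), Or.inr hv'⟩
    have hq : F (F.symm q) = q := F.apply_symm_apply q
    rcases (F.symm q).2 with h0 | h0
    · have h1 := hzero _ h0
      rw [hq] at h1
      exact absurd h1 hv'.1
    · refine ⟨⟨(F.symm q).1.2, (F.symm q).1.1, (F.symm q).1.1.2, h0⟩, Subtype.ext ?_⟩
      have h2 : P ⟨(F.symm q).1.2, (F.symm q).1.1, (F.symm q).1.1.2, h0⟩ = F.symm q :=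
        Subtype.ext (Prod.ext (hP _ _ h0) rfl)
      simp only [h2, hq, q]
  · intro v x h
    have := hlift (P v) (hπlift v)
    rwa [hP v x h] at this
  · intro t v v' e
    obtain ⟨l, u, -, -, -, h⟩ := hF (P v).1.1
    obtain ⟨s, hs⟩ := l.isLift_z.exists_eq_wsmul (hπlift v)
    have hs' : (v' : DualSum W) = wsmul k (t * s) l.z := by rw [e, wsmul_mul, ← hs]
    have hx : (P v').1.1 = (P v).1.1 := hP _ _ (by rw [e]; exact (hπlift v).wsmul t.ne_zero)
    have h1 := (h l.z s (P v) l.isLift_z hs).2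
    have h2 := (h l.z (t * s) (P v') (by rw [hx]; exact l.isLift_z) hs').2
    change (F (P v')).1.2 = wsmul k t (F (P v)).1.2
    rw [h1, h2, mul_assoc, wsmul_mul]
  · intro x
    obtain ⟨l, u, hu, hu0, -, h⟩ := hF x
    refine ⟨l, u, hu, hu0, fun y => ?_⟩
    have := (h y 1 (P ⟨y, y.2.1.1⟩) (hπlift ⟨y, y.2.1.1⟩) (wsmul_one k _).symm).2
    rwa [one_mul] at this

/-- Sections pull back to sections along an isomorphism of cones. -/
theorem IsConeIso.comp_mem_sections (hk : 0 < k) {X Y : Set (WProj k W)} {f : X ≃ₜ Y}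
    {G : cone X → cone Y} (hG : IsConeIso f G) {d : ℕ} {s : cone Y → ℂ}
    (hs : s ∈ sections Y d) : s ∘ G ∈ sections X d := by
  refine ⟨fun t v v' e => hs.1 t _ _ (hG.map_wsmul t v v' e), fun c p => ?_⟩
  obtain ⟨x, hx, hpx⟩ := p.2.1
  -- The lift `l` lives in its own chart `l.a`, usually not in `c`. The holomorphic rescaling `ρ y =
  -- τ y · y` moves a neighbourhood of `p` in the slice of `c` into that of `l.a`, with `p` going to
  -- `l.z`.
  obtain ⟨l, u, hu, hu0, hloc⟩ := hG.exists_local ⟨x, hx⟩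
  obtain ⟨t, ht⟩ := hpx.exists_eq_wsmul l.isLift_z
  obtain ⟨O, τ, hO, hpO, hτ, hτp, hτO⟩ := exists_scaling_to_slice (t := t) hk l.a (p : DualSum W)
    (by rw [← ht]; exact l.z.2.1.2)
  obtain ⟨O₁, hO₁, hz₁, U, hU, eU⟩ := hu l.z
  obtain ⟨O₂, hO₂, hz₂, Φ, hΦ, eΦ⟩ := l.holomorphic l.z
  obtain ⟨O₃, hO₃, hz₃, S, hS, eS⟩ := hs.2 l.b ⟨l.φ l.z, (l.φ l.z).2.1⟩
  set ρ : DualSum W → DualSum W := fun y => wsmul k (τ y) y with hρ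
  have hρd : DifferentiableOn ℂ ρ O := differentiableOn_wsmul hτ
  have hρp : ρ p = l.z := by rw [hρ, ht, ← hτp]
  have hN : IsOpen (O₂ ∩ Φ ⁻¹' O₃) := hΦ.continuousOn.isOpen_inter_preimage hO₂ hO₃
  have hN' : IsOpen (O ∩ ρ ⁻¹' (l.O ∩ O₁ ∩ (O₂ ∩ Φ ⁻¹' O₃))) :=
    hρd.continuousOn.isOpen_inter_preimage hO ((l.isOpen_O.inter hO₁).inter hN)
  -- By equivariance `s (G y) = τ⁻ᵈ s (G (ρ y))`, and `G (ρ y) = u · φ (ρ y)` gives `s (G (ρ y)) =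
  -- uᵈ s (φ (ρ y))`. Each factor extends holomorphically to the ambient space.
  refine ⟨_, hN', ⟨hpO, ?_⟩, fun y => (τ y)⁻¹ ^ d * (U (ρ y) ^ d * S (Φ (ρ y))), ?_, ?_⟩
  · rw [mem_preimage, hρp]
    exact ⟨⟨l.z.2.2, hz₁⟩, hz₂, by rw [mem_preimage, eΦ l.z hz₂]; exact hz₃⟩
  · have hρN := hρd.mono (inter_subset_left (s := O) (t := ρ ⁻¹' (l.O ∩ O₁ ∩ (O₂ ∩ Φ ⁻¹' O₃))))
    refine (((hτ.mono inter_subset_left).inv fun y hy => (hτO y hy.1).1).pow d).mul ?_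
    exact ((hU.comp hρN fun y hy => hy.2.1.2).pow d).mul
      (hS.comp (hΦ.comp hρN fun y hy => hy.2.2.1) fun y hy => hy.2.2.2)
  · rintro y ⟨hyO, ⟨hy₀, hy₁⟩, hy₂, hy₃⟩
    obtain ⟨hτ0, hτ1⟩ := hτO y hyO
    let y' : (chart X l.a ∩ l.O : Set (DualSum W)) :=
      ⟨ρ y, ⟨wsmul_mem_cone y.2.1 hτ0, hτ1⟩, hy₀⟩
    have e1 : U (ρ y) = u y' := eU y' hy₁
    have e2 : Φ (ρ y) = l.φ y' := eΦ y' hy₂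
    rw [mem_preimage, e2] at hy₃
    have e3 : S (l.φ y') = s ⟨l.φ y', (l.φ y').2.1.1⟩ := eS ⟨l.φ y', (l.φ y').2.1⟩ hy₃
    have e4 := hs.1 (Units.mk0 _ (hu0 y')) ⟨l.φ y', (l.φ y').2.1.1⟩ (G ⟨y', y'.2.1.1⟩) (hloc y')
    have e5 := hs.1 (Units.mk0 _ hτ0) (G ⟨y, y.2.1⟩) (G ⟨y', y'.2.1.1⟩)
      (hG.map_wsmul (Units.mk0 _ hτ0) ⟨y, y.2.1⟩ ⟨y', y'.2.1.1⟩ rfl)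
    rw [Units.val_mk0] at e4 e5
    change (τ y)⁻¹ ^ d * (U (ρ y) ^ d * S (Φ (ρ y))) = s (G ⟨y, y.2.1⟩)
    rw [e1, e2, e3, ← e4, e5, ← mul_assoc, ← mul_pow, inv_mul_cancel₀ hτ0, one_pow, one_mul]

/-- In normally embedded orbifolds an isomorphism of cones is the transpose of injective linear
maps of the coordinates. -/
theorem IsConeIso.exists_linearMap (hk : 0 < k) {X Y : Set (WProj k W)} {f : X ≃ₜ Y}
    {G : cone X → cone Y} (hG : IsConeIso f G) (hX : IsNormallyEmbedded X)
    (hY : IsNormallyEmbedded Y) (i : Fin (M + 1)) :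
    ∃ A : W i →ₗ[ℂ] W i, Function.Injective A ∧
      ∀ (v : cone X) (w : W i), (G v : DualSum W) i w = (v : DualSum W) i (A w) := by
  let r (Z : Set (WProj k W)) := restrictSections Z (k + (i : ℕ)) ∘ₗ coordSection (W := W) k i
  let pull : sections Y (k + (i : ℕ)) →ₗ[ℂ] sections X (k + (i : ℕ)) :=
    { toFun := fun s => ⟨s.1 ∘ G, hG.comp_mem_sections hk s.2⟩
      map_add' := fun _ _ => rfl
      map_smul' := fun _ _ => rfl }
  have hpull : Function.Injective pull := fun s s' h =>
    Subtype.ext (hG.surjective.injective_comp_right (congrArg Subtype.val h))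
  let e := LinearEquiv.ofBijective (r X) (hX i)
  refine ⟨e.symm.toLinearMap ∘ₗ pull ∘ₗ r Y,
    e.symm.injective.comp (hpull.comp (hY i).injective), fun v w => ?_⟩
  -- The sections `A w` on `X` and `w ∘ G` agree; evaluating at `v` gives the transpose formula.
  have h := e.apply_symm_apply (pull (r Y w))
  exact (congrFun (congrArg Subtype.val h) v).symm

/-! ### The action of `∏ᵢ GL(W i)` -/

variable [∀ i, FiniteDimensional ℂ (W i)]

theorem glAct_apply (g : ∀ i, LinearMap.GeneralLinearGroup ℂ (W i)) (v : DualSum W)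
    (i : Fin (M + 1)) (w : W i) : glAct g v i w = v i (((g i)⁻¹).1 w) := rfl

theorem glAct_inv_glAct (g : ∀ i, LinearMap.GeneralLinearGroup ℂ (W i)) (v : DualSum W) :
    glAct g⁻¹ (glAct g v) = v := by
  funext i
  ext w
  rw [glAct_apply, glAct_apply, ← Module.End.mul_apply, ← Units.val_mul, Pi.inv_apply,
    mul_inv_cancel, Units.val_one, Module.End.one_apply]

theorem glAct_glAct_inv (g : ∀ i, LinearMap.GeneralLinearGroup ℂ (W i)) (v : DualSum W) :
    glAct g (glAct g⁻¹ v) = v := by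
  simpa using glAct_inv_glAct g⁻¹ v

theorem glAct_apply_apply (g : ∀ i, LinearMap.GeneralLinearGroup ℂ (W i)) (v : DualSum W)
    (i : Fin (M + 1)) (w : W i) : glAct g v i ((g i).1 w) = v i w := by
  rw [glAct_apply, ← Module.End.mul_apply, Units.inv_mul, Module.End.one_apply]

theorem differentiable_glAct (g : ∀ i, LinearMap.GeneralLinearGroup ℂ (W i)) :
    Differentiable ℂ (glAct g : DualSum W → DualSum W) := by
  rw [differentiable_pi]
  intro i
  simp only [glAct]
  fun_prop

theorem IsLift.glAct {v : DualSum W} {x : WProj k W} (h : IsLift v x)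
    (g : ∀ i, LinearMap.GeneralLinearGroup ℂ (W i)) : IsLift (glAct g v) (projAct g x) := by
  obtain ⟨hv, rfl⟩ := h
  exact ⟨glAct_ne_zero g hv, rfl⟩

theorem projAct_inv_projAct (g : ∀ i, LinearMap.GeneralLinearGroup ℂ (W i)) (x : WProj k W) :
    projAct g⁻¹ (projAct g x) = x := by
  obtain ⟨v, hv⟩ := exists_isLift x
  have h := (hv.glAct g).glAct g⁻¹
  rw [glAct_inv_glAct] at h
  exact h.unique hv

theorem continuous_projAct (g : ∀ i, LinearMap.GeneralLinearGroup ℂ (W i)) :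
    Continuous (projAct g : WProj k W → WProj k W) := by
  refine continuous_quot_lift _ (continuous_quot_mk.comp ?_)
  exact ((differentiable_glAct g).continuous.comp continuous_subtype_val).subtype_mk _

/-- The homeomorphism of weighted projective space given by an element of `∏ᵢ GL(W i)`. -/
noncomputable def projHomeo (k : ℕ) (g : ∀ i, LinearMap.GeneralLinearGroup ℂ (W i)) :
    WProj k W ≃ₜ WProj k W where
  toFun := projAct g
  invFun := projAct g⁻¹
  left_inv := projAct_inv_projAct g
  right_inv x := by simpa using projAct_inv_projAct g⁻¹ x
  continuous_toFun := continuous_projAct g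
  continuous_invFun := continuous_projAct g⁻¹

/-! ### The isomorphism induced by a graded linear automorphism -/

variable (X : Set (WProj k W)) (g : ∀ i, LinearMap.GeneralLinearGroup ℂ (W i))

/-- The restriction of the action of `g` to `X`, as a homeomorphism onto the image. -/
noncomputable def projHomeoImage : X ≃ₜ (projAct g '' X : Set (WProj k W)) := (projHomeo k g).image X

theorem projHomeoImage_coe (x : X) :
    (projHomeoImage X g x : WProj k W) = projAct g (x : WProj k W) := rfl

theorem projAct_projHomeoImage_symm (y : (projAct g '' X : Set (WProj k W))) :
    projAct g⁻¹ (y : WProj k W) = (projHomeoImage X g).symm y := by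
  obtain ⟨x, rfl⟩ := (projHomeoImage X g).surjective y
  rw [Homeomorph.symm_apply_apply, projHomeoImage_coe, projAct_inv_projAct]

-- The action on dual vectors is contragredient, so it takes the slice of `w` to the slice of `g w`,
-- of the same weight.
variable {X} in
theorem glAct_mem_chart {c : ChartIndex W} {v : DualSum W} (hv : v ∈ chart X c) :
    glAct g v ∈ chart (projAct g '' X) ⟨c.1, (g c.1).1 c.2⟩ := by
  obtain ⟨⟨x, hx, h⟩, hc⟩ := hv
  exact ⟨⟨_, mem_image_of_mem _ hx, h.glAct g⟩, by rw [glAct_apply_apply, hc]⟩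

variable {X} in
theorem glAct_inv_mem_chart {c : ChartIndex W} {v : DualSum W}
    (hv : v ∈ chart (projAct g '' X) ⟨c.1, (g c.1).1 c.2⟩) : glAct g⁻¹ v ∈ chart X c := by
  obtain ⟨⟨_, ⟨x, hx, rfl⟩, h⟩, hc⟩ := hv
  refine ⟨⟨x, hx, ?_⟩, ?_⟩
  · simpa [projAct_inv_projAct] using h.glAct g⁻¹
  · simpa [glAct_apply] using hc

theorem stab_glAct (v : DualSum W) : stab k (glAct g v) = stab k v := by
  ext t
  change wsmul k t (glAct g v) = glAct g v ↔ wsmul k t v = v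
  rw [← glAct_wsmul]
  exact (Function.LeftInverse.injective (glAct_inv_glAct g)).eq_iff

/-- The action of `g` on a whole chart of `X`, as a lift of its action on `X`. -/
noncomputable def glChartLift (x : X) (c : ChartIndex W) (z : DualSum W) (hz : IsLift z (x : WProj k W))
    (hc : z c.1 c.2 = 1) : ChartLift (projHomeoImage X g) x where
  a := c
  b := ⟨c.1, (g c.1).1 c.2⟩
  O := univ
  O' := univ
  isOpen_O := isOpen_univ
  isOpen_O' := isOpen_univ
  φ :=
    { toFun := fun y => ⟨glAct g y, glAct_mem_chart g y.2.1, mem_univ _⟩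
      invFun := fun y => ⟨glAct g⁻¹ y, glAct_inv_mem_chart g y.2.1, mem_univ _⟩
      left_inv := fun y => Subtype.ext (glAct_inv_glAct g y)
      right_inv := fun y => Subtype.ext (glAct_glAct_inv g y) }
  holomorphic := IsHolomorphic.of_differentiable _ (differentiable_glAct g)
  holomorphic_symm := IsHolomorphic.of_differentiable _ (differentiable_glAct g⁻¹)
  z := ⟨z, ⟨⟨x, x.2, hz⟩, hc⟩, mem_univ _⟩
  isLift_z := hz
  covers := fun _ _ h => h.glAct g
  θ := MulEquiv.subgroupCongr (stab_glAct g z).symm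
  stable := fun t y =>
    ⟨wsmul_mem_chart y.2.1 (pow_eq_one_of_mem_stab hc t.2), mem_univ _⟩
  equivariant := fun _ _ => glAct_wsmul g _ _

/-- The action of `g` on the tautological bundle. -/
noncomputable def glTautEquiv : TautBundle X ≃ TautBundle (projAct g '' X) where
  toFun p := ⟨(projHomeoImage X g p.1.1, glAct g p.1.2), p.2.imp
    (fun h => by rw [h]; funext i; ext w; simp [glAct_apply]) fun h => h.glAct g⟩
  invFun p := ⟨((projHomeoImage X g).symm p.1.1, glAct g⁻¹ p.1.2), p.2.imp
    (fun h => by rw [h]; funext i; ext w; simp [glAct_apply])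
    fun h => by rw [← projAct_projHomeoImage_symm]; exact h.glAct g⁻¹⟩
  left_inv p := Subtype.ext (Prod.ext (Homeomorph.symm_apply_apply _ _) (glAct_inv_glAct g _))
  right_inv p := Subtype.ext (Prod.ext (Homeomorph.apply_symm_apply _ _) (glAct_glAct_inv g _))

theorem isTautIso_glTautEquiv : IsTautIso (projHomeoImage X g) (glTautEquiv X g) := by
  intro x
  obtain ⟨z, hz⟩ := exists_isLift (x : WProj k W)
  obtain ⟨c, hc⟩ := exists_coord_eq_one hz.1
  refine ⟨glChartLift X g x c z hz hc, fun _ => 1,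
    IsHolomorphic.of_differentiable _ (Φ := fun _ => (1 : ℂ)) (differentiable_const _),
    fun _ => one_ne_zero, fun _ _ => rfl, fun y s p _ e => ⟨rfl, ?_⟩⟩
  change glAct g p.1.2 = wsmul k (s * 1) (glAct g y)
  rw [e, glAct_wsmul, mul_one]

theorem polarisedIsomorphic_image : PolarisedIsomorphic X (projAct g '' X) :=
  ⟨projHomeoImage X g, fun x => let ⟨l, _⟩ := isTautIso_glTautEquiv X g x; ⟨l⟩,
    glTautEquiv X g, isTautIso_glTautEquiv X g⟩

/-! ### Linearity of isomorphisms of normally embedded orbifolds -/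

variable {X} in
theorem PolarisedIsomorphic.exists_projAct_image_eq (hk : 0 < k) {Y : Set (WProj k W)}
    (h : PolarisedIsomorphic X Y) (hX : IsNormallyEmbedded X) (hY : IsNormallyEmbedded Y) :
    ∃ g : ∀ i, LinearMap.GeneralLinearGroup ℂ (W i), projAct g '' X = Y := by
  obtain ⟨f, -, F, hF⟩ := h
  obtain ⟨G, hG⟩ := exists_isConeIso hk hF
  choose A hA hGA using hG.exists_linearMap hk hX hY
  -- `glAct` precomposes with the inverse, so precomposition with `A` is the action of `a⁻¹`.
  let a (i : Fin (M + 1)) : LinearMap.GeneralLinearGroup ℂ (W i) :=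
    LinearMap.GeneralLinearGroup.ofLinearEquiv (LinearEquiv.ofInjectiveEndo (A i) (hA i))
  have hGa : ∀ v : cone X, (G v : DualSum W) = glAct a⁻¹ v := by
    intro v
    funext i
    ext w
    rw [hGA, glAct_apply, Pi.inv_apply, inv_inv]
    rfl
  have hf : ∀ x : X, projAct a⁻¹ (x : WProj k W) = f x := by
    intro x
    obtain ⟨v, hv⟩ := exists_isLift (x : WProj k W)
    have h := hG.isLift ⟨v, x, x.2, hv⟩ x hv
    rw [hGa] at h
    exact (hv.glAct a⁻¹).unique h
  refine ⟨a⁻¹, Subset.antisymm ?_ fun y hy => ?_⟩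
  · rintro _ ⟨x, hx, rfl⟩
    rw [hf ⟨x, hx⟩]
    exact (f ⟨x, hx⟩).2
  · obtain ⟨x, hx⟩ := f.surjective ⟨y, hy⟩
    exact ⟨x, x.2, by rw [hf, hx]⟩

end WeightedEmbedding

theorem mainTheorem10 {M : ℕ} (k : ℕ) (hk : 0 < k) {W : Fin (M + 1) → Type*}
    [∀ i, NormedAddCommGroup (W i)] [∀ i, NormedSpace ℂ (W i)]
    [∀ i, FiniteDimensional ℂ (W i)]
    (X₁ X₂ : Set (WeightedEmbedding.WProj k W))
    (h₁ : WeightedEmbedding.IsEmbeddedOrbifold X₁)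
    (h₂ : WeightedEmbedding.IsEmbeddedOrbifold X₂)
    (n₁ : WeightedEmbedding.IsNormallyEmbedded X₁)
    (n₂ : WeightedEmbedding.IsNormallyEmbedded X₂) :
    WeightedEmbedding.PolarisedIsomorphic X₁ X₂ ↔
      ∃ g : ∀ i, LinearMap.GeneralLinearGroup ℂ (W i),
        WeightedEmbedding.projAct g '' X₁ = X₂ :=
  ⟨fun h => h.exists_projAct_image_eq hk n₁ n₂, by
    rintro ⟨g, rfl⟩
    exact WeightedEmbedding.polarisedIsomorphic_image X₁ g⟩
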